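/- **Proposition.** Let $X$ be a real reflexive Banach space with dual $X^*$, and let $f:X\to\mathbb R\cup\{+\infty\}$ be proper, convex and lower semicontinuous. Write $\partial_\epsilon f(x)=\{x^*: f(y)-f(x)\ge\langle y-x,x^*\rangle-\epsilon\ \ \forall y\in X\}$ if $f(x)<+\infty$, $\partial_\epsilon f(x)=\emptyset$ otherwise, and $T=\partial f=\partial_0 f$. Use the pairing $\langle (x,x^*),(y^*,y)\rangle=\langle x,y^*\rangle+\langle y,x^*\rangle$ between $X\times X^*$ and $X^*\times X$, and put $i(x,x^*)=(x^*,x)$. Let $$\mathcal F_{T}(x,x^*)=\sup\{\langle y,x^*\rangle+\langle x-y,y^*\rangle : y^*\in T(y)\}$$ be the Fitzpatrick function of $T$ and let $\mathcal F_T^*$ be its conjugate, a function on $X^*\times X$. For $h:X\times X^*\to\mathbb R\cup\{+\infty\}$, $\epsilon\ge0$ and $x\in X$ put $$\breve T_h(\epsilon,x)=\{x^*: (x^*,x)\in\partial_{2\epsilon}h(x,x^*)\},\qquad L^h(\epsilon,x)=\{x^*: h(x,x^*)\le\langle x,x^*\rangle+\epsilon\}.$$ A closed enlargement of $T$ is a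 multifunction $E:\mathbb R_+\times X\rightrightarrows X^*$ with closed graph such that (E1) $T(x)\subset E(\epsilon,x)$ for all $\epsilon\ge 0$, $x\in X$; (E2) $E(\epsilon_1,x)\subset E(\epsilon_2,x)$ whenever $0\le\epsilon_1\le\epsilon_2$; (E3) if $x_1^*\in E(\epsilon_1,x_1)$, $x_2^*\in E(\epsilon_2,x_2)$, $\alpha\in[0,1]$, $\hat x=\alpha x_1+(1-\alpha)x_2$, $\hat x^*=\alpha x_1^*+(1-\alpha)x_2^*$ and $\epsilon=\alpha\epsilon_1+(1-\alpha)\epsilon_2+\alpha\langle x_1-\hat x,x_1^*-\hat x^*\rangle+(1-\alpha)\langle x_2-\hat x,x_2^*-\hat x^*\rangle$, then $\epsilon\ge0$ and $\hat x^*\in E(\epsilon,\hat x)$. Let $T^{\mathrm{SE}}(\epsilon,x)$ be the intersection of the sets $E(\epsilon,x)$ over all closed enlargements $E$ of $T$. Then $T^{\mathrm{SE}}$ is itself a closed enlargement of $T$ (hence the smallest one), $T^{\mathrm{SE}}=L^{\mathcal F_{T}^*\circ i}$, and for every $\epsilon\ge0$ and $x\in X$ $$\breve T_{\mathcal F_{\partial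 f}}(\epsilon/2,x)\subset T^{\mathrm{SE}}(\epsilon,x).$$ -/

import Mathlib

open scoped NNReal

namespace ConvEnl

noncomputable section

variable {Z : Type*} [NormedAddCommGroup Z] [NormedSpace ℝ Z]
variable {X : Type*} [NormedAddCommGroup X] [NormedSpace ℝ X]

/-- A normed space is reflexive if the canonical embedding into its bidual is onto. -/
def Reflexive (Z : Type*) [NormedAddCommGroup Z] [NormedSpace ℝ Z] : Prop :=
  Function.Surjective (NormedSpace.inclusionInDoubleDual ℝ Z)

/-- `f` is a proper function with values in `ℝ ∪ {+∞}`: it never takes the value `-∞`,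
and its domain is nonempty. -/
def IsProper (f : Z → EReal) : Prop :=
  (∀ z, f z ≠ ⊥) ∧ ∃ z, f z < ⊤

/-- Convexity of an extended-real-valued function: its epigraph is convex. -/
def IsConvexFun (f : Z → EReal) : Prop :=
  Convex ℝ {p : Z × ℝ | f p.1 ≤ (p.2 : EReal)}

/-- The `ε`-subdifferential `∂_ε f (z)`; it is empty when `z ∉ dom f`. -/
def epsSubdiff (f : Z → EReal) (ε : ℝ≥0) (z : Z) : Set (StrongDual ℝ Z) :=
  {z' | f z < ⊤ ∧ ∀ w : Z, ((z' (w - z) - (ε : ℝ) : ℝ) : EReal) ≤ f w - f z}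

/-- The subdifferential `∂f`. -/
def subdiff (f : Z → EReal) (z : Z) : Set (StrongDual ℝ Z) :=
  epsSubdiff f 0 z

/-- The Fenchel-Moreau conjugate `f*(z*) = sup_z (⟨z, z*⟩ - f(z))`. -/
def conj (f : Z → EReal) (z' : StrongDual ℝ Z) : EReal :=
  ⨆ z : Z, ((z' z : ℝ) : EReal) - f z

/-- The element of the dual of `X × X*` given by the pair `(y*, y) ∈ X* × X`, through the pairing
`⟨(x, x*), (y*, y)⟩ = ⟨x, y*⟩ + ⟨y, x*⟩`. -/
def dualPair (y' : StrongDual ℝ X) (y : X) : StrongDual ℝ (X × StrongDual ℝ X) :=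
  y'.comp (ContinuousLinearMap.fst ℝ X (StrongDual ℝ X)) +
    (NormedSpace.inclusionInDoubleDual ℝ X y).comp
      (ContinuousLinearMap.snd ℝ X (StrongDual ℝ X))

theorem dualPair_apply (y' : StrongDual ℝ X) (y : X) (p : X × StrongDual ℝ X) :
    dualPair y' y p = y' p.1 + p.2 y := rfl

/-- `h* ∘ i`, where `i (x, x*) = (x*, x)`. -/
def conjSwap (h : X × StrongDual ℝ X → EReal) (p : X × StrongDual ℝ X) : EReal :=
  conj h (dualPair p.2 p.1)

/-- The Fitzpatrick function
`F_T (x, x*) = sup {⟨y, x*⟩ + ⟨x - y, y*⟩ : (y, y*) ∈ gph T}`. -/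
def fitzpatrick (T : X → Set (StrongDual ℝ X)) (p : X × StrongDual ℝ X) : EReal :=
  ⨆ (y : X) (y' : StrongDual ℝ X) (_ : y' ∈ T y), ((p.2 y + y' (p.1 - y) : ℝ) : EReal)

/-- `T̆_h (ε, x) = {x* : (x*, x) ∈ ∂_{2ε} h (x, x*)}`. -/
def breveEnl (h : X × StrongDual ℝ X → EReal) (ε : ℝ≥0) (x : X) : Set (StrongDual ℝ X) :=
  {x' | dualPair x' x ∈ epsSubdiff h (2 * ε) (x, x')}

/-- `L^h (ε, x) = {x* : h (x, x*) ≤ ⟨x, x*⟩ + ε}`. -/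
def levelEnl (h : X × StrongDual ℝ X → EReal) (ε : ℝ≥0) (x : X) : Set (StrongDual ℝ X) :=
  {x' | h (x, x') ≤ ((x' x + (ε : ℝ) : ℝ) : EReal)}

/-- The family `𝔼(T)` of enlargements of `T`: `T ⊆ E`, monotonicity in `ε`, and the
transportation formula. -/
structure IsEnlargement (T : X → Set (StrongDual ℝ X))
    (E : ℝ≥0 → X → Set (StrongDual ℝ X)) : Prop where
  subset : ∀ (ε : ℝ≥0) (x : X), T x ⊆ E ε x
  mono : ∀ (ε₁ ε₂ : ℝ≥0), ε₁ ≤ ε₂ → ∀ x : X, E ε₁ x ⊆ E ε₂ x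
  transport : ∀ (ε₁ ε₂ : ℝ≥0) (x₁ x₂ : X) (x₁' x₂' : StrongDual ℝ X) (α : ℝ),
    x₁' ∈ E ε₁ x₁ → x₂' ∈ E ε₂ x₂ → 0 ≤ α → α ≤ 1 →
    ∀ (x : X) (x' : StrongDual ℝ X) (ε : ℝ),
      x = α • x₁ + (1 - α) • x₂ →
      x' = α • x₁' + (1 - α) • x₂' →
      ε = α * ε₁ + (1 - α) * ε₂ + α * (x₁' - x') (x₁ - x) + (1 - α) * (x₂' - x') (x₂ - x) →
      ∃ hε : 0 ≤ ε, x' ∈ E ⟨ε, hε⟩ x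

/-- The enlargements of `T` whose graph is closed in `ℝ₊ × X × X*`. -/
def closedEnl (T : X → Set (StrongDual ℝ X)) : Set (ℝ≥0 → X → Set (StrongDual ℝ X)) :=
  {E | IsEnlargement T E ∧
    IsClosed {q : ℝ≥0 × X × StrongDual ℝ X | q.2.2 ∈ E q.1 q.2.1}}

/-- `T^SE`: the intersection of all closed enlargements of `T`. It is the smallest closed
enlargement as soon as it is itself a closed enlargement. -/
def smallestEnl (T : X → Set (StrongDual ℝ X)) (ε : ℝ≥0) (x : X) : Set (StrongDual ℝ X) :=
  {x' | ∀ E ∈ closedEnl T, x' ∈ E ε x}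

end

end ConvEnl

open scoped NNReal

namespace ConvEnl

/-! Put `T = ∂f`. Minimizing `f - x₀' + ½‖· - x₀‖²`, possible by weak compactness, shows that `T` is
maximal monotone. Hence `F_T` dominates the pairing, with equality on the graph, and so `F_T* ∘ i`
dominates it too.

The transportation formula for `E` says exactly that the set of `(x, x', s)` with `s ≥ ⟨x, x'⟩` and
`x' ∈ E (s - ⟨x, x'⟩, x)` is convex. As `F_T* ∘ i` is convex and dominates the pairing, its level
sets form a closed enlargement. Conversely, for any closed enlargement this set is closed, convex
and contains the graph of `T` lifted by the pairing. By reflexivity a functional separating a point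
from it is given by a pair, and testing the conjugate near that pair shows that the point is not in
the level enlargement. The last inclusion is the subgradient inequality combined with `F_T ≥ ⟨·,·⟩`.
-/

/-- In a reflexive space, bounded closed convex sets are weakly compact. -/
theorem isCompact_toWeakSpace_image {X : Type*} [NormedAddCommGroup X] [NormedSpace ℝ X]
    (hX : Reflexive X) {s : Set X} (hconv : Convex ℝ s) (hcl : IsClosed s)
    (hb : Bornology.IsBounded s) : IsCompact (toWeakSpace ℝ X '' s) := by
  have hclosure : closure (toWeakSpace ℝ X '' s) = toWeakSpace ℝ X '' s := by
    rw [← hconv.toWeakSpace_closure ℝ, hcl.closure_eq]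
  rw [← hclosure]
  refine NormedSpace.isCompact_closure_of_isBounded ℝ X _ ?_ ?_
  · rwa [Set.preimage_image_eq _ (toWeakSpace ℝ X).injective]
  · have hsurj : Function.Surjective (NormedSpace.inclusionInDoubleDualWeak ℝ X) := fun y =>
      (hX (WeakDual.toStrongDual y)).imp fun _ hx => hx
    rw [hsurj.range_eq]
    exact Set.subset_univ _

theorem isClosed_toWeakSpace_image {X : Type*} [NormedAddCommGroup X] [NormedSpace ℝ X]
    {s : Set X} (hconv : Convex ℝ s) (hcl : IsClosed s) :
    IsClosed (toWeakSpace ℝ X '' s) := by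
  rw [← closure_eq_iff_isClosed, ← hconv.toWeakSpace_closure ℝ, hcl.closure_eq]

theorem isClosed_epigraph {Z : Type*} [TopologicalSpace Z] {f : Z → EReal}
    (hf : LowerSemicontinuous f) : IsClosed {p : Z × ℝ | f p.1 ≤ (p.2 : EReal)} :=
  hf.isClosed_epigraph.preimage (f := fun p : Z × ℝ => (p.1, (p.2 : EReal)))
    (continuous_fst.prodMk (continuous_coe_real_ereal.comp continuous_snd))

theorem clm_prod_real_apply {Z : Type*} [NormedAddCommGroup Z] [NormedSpace ℝ Z]
    (Φ : StrongDual ℝ (Z × ℝ)) (z : Z) (s : ℝ) :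
    Φ (z, s) = Φ (z, 0) + s * Φ (0, 1) := by
  rw [← smul_eq_mul, ← map_smul, ← map_add]
  simp

/-! ### Maximal monotonicity of the subdifferential. -/

section

variable {X : Type*} [NormedAddCommGroup X] [NormedSpace ℝ X] {f : X → EReal}

/-- Every proper convex lower semicontinuous function has a continuous affine minorant. -/
theorem exists_affine_minorant (hproper : IsProper f) (hconv : IsConvexFun f)
    (hlsc : LowerSemicontinuous f) :
    ∃ (φ : StrongDual ℝ X) (c : ℝ), ∀ (x : X) (s : ℝ), f x ≤ s → φ x - c ≤ s := by
  obtain ⟨hbot, z, hz⟩ := hproper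
  lift f z to ℝ using ⟨hz.ne, hbot z⟩ with r hr
  obtain ⟨Φ, u, hu, hΦ⟩ := geometric_hahn_banach_point_closed (x := (z, r - 1)) hconv
    (isClosed_epigraph hlsc) (by
      rw [Set.mem_ofPred_eq, ← hr, EReal.coe_le_coe_iff]; linarith)
  have h1 := hΦ (z, r) (by simp [← hr])
  rw [clm_prod_real_apply] at hu h1
  have hβ : 0 < Φ (0, 1) := by linarith
  refine ⟨-(Φ (0, 1))⁻¹ • Φ.comp (ContinuousLinearMap.inl ℝ X ℝ), -(Φ (0, 1))⁻¹ * u,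
    fun x s hs => ?_⟩
  have h2 := hΦ (x, s) hs
  rw [clm_prod_real_apply] at h2
  simp only [_root_.smul_apply, ContinuousLinearMap.comp_apply,
    ContinuousLinearMap.inl_apply, smul_eq_mul]
  have : (Φ (0, 1))⁻¹ * (u - Φ (x, 0)) ≤ s := by
    rw [inv_mul_le_iff₀ hβ]; linarith
  linarith

/-- The sum of a proper convex lower semicontinuous function and a real convex continuous function
has a minimizer on a reflexive space, as soon as its sublevel sets are bounded. -/
theorem exists_minimizer_add (hX : Reflexive X) (hproper : IsProper f) (hconv : IsConvexFun f)
    (hlsc : LowerSemicontinuous f) {k : X → ℝ} (hk : ConvexOn ℝ Set.univ k) (hkc : Continuous k)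
    (hb : ∀ c : ℝ, Bornology.IsBounded {x | f x ≤ ((c - k x : ℝ) : EReal)}) :
    ∃ (z : X) (r : ℝ), f z = r ∧ ∀ (x : X) (s : ℝ), f x ≤ s → r + k z ≤ s + k x := by
  obtain ⟨hbot, z₀, hz₀⟩ := hproper
  let S : ℝ → Set X := fun c => {x | f x ≤ ((c - k x : ℝ) : EReal)}
  have hScl (c : ℝ) : IsClosed (S c) :=
    (isClosed_epigraph hlsc).preimage (f := fun x => (x, c - k x)) (by fun_prop)
  have hSconv (c : ℝ) : Convex ℝ (S c) := by
    intro x hx y hy a b ha hb hab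
    have h1 : f (a • x + b • y) ≤ ((a • (c - k x) + b • (c - k y) : ℝ) : EReal) :=
      hconv (x := (x, c - k x)) hx (y := (y, c - k y)) hy ha hb hab
    refine h1.trans (EReal.coe_le_coe_iff.2 ?_)
    have h2 := hk.2 (Set.mem_univ x) (Set.mem_univ y) ha hb hab
    simp only [smul_eq_mul] at h2 ⊢
    have : a * c + b * c = c := by rw [← add_mul, hab, one_mul]
    linarith
  have hSmono {c d : ℝ} (hcd : c ≤ d) : S c ⊆ S d := fun x hx =>
    le_trans hx (EReal.coe_le_coe_iff.2 (by linarith))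
  have hmem {x : X} {s : ℝ} (hs : f x ≤ s) : x ∈ S (s + k x) := by
    simpa only [S, Set.mem_ofPred_eq, add_sub_cancel_right] using hs
  -- The nonempty sublevel sets form a chain of weakly compact sets; a point common to all of them
  -- is a minimizer.
  let ι := {c : ℝ // (S c).Nonempty}
  lift f z₀ to ℝ using ⟨hz₀.ne, hbot z₀⟩ with r₀ hr₀
  have : Nonempty ι := ⟨⟨_, z₀, hmem hr₀.symm.le⟩⟩
  obtain ⟨w, hw⟩ := IsCompact.nonempty_iInter_of_directed_nonempty_isCompact_isClosed
    (fun c : ι => toWeakSpace ℝ X '' S c.1)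
    (directed_of_isDirected_ge fun c d hcd => Set.image_mono (hSmono hcd))
    (fun c => c.2.image _)
    (fun c => isCompact_toWeakSpace_image hX (hSconv _) (hScl _) (hb _))
    (fun c => isClosed_toWeakSpace_image (hSconv _) (hScl _))
  have hw' (x : X) (s : ℝ) (hs : f x ≤ s) : (toWeakSpace ℝ X).symm w ∈ S (s + k x) := by
    obtain ⟨y, hy, rfl⟩ := Set.mem_iInter.1 hw ⟨_, x, hmem hs⟩
    simpa using hy
  generalize (toWeakSpace ℝ X).symm w = z at hw'
  have hz : f z < ⊤ := lt_of_le_of_lt (hw' z₀ r₀ hr₀.symm.le) (EReal.coe_lt_top _)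
  obtain ⟨r, hr⟩ : ∃ r : ℝ, f z = r := ⟨(f z).toReal, (EReal.coe_toReal hz.ne (hbot z)).symm⟩
  refine ⟨z, r, hr, fun x s hs => ?_⟩
  have := hw' x s hs
  simp only [S, Set.mem_ofPred_eq, hr, EReal.coe_le_coe_iff] at this
  linarith

/-- If `z` minimizes `f + k` with `f` convex and `k` real convex continuous, then some continuous
linear functional is a subgradient of `f` at `z` whose opposite is a subgradient of `k` at `z`. -/
theorem exists_subgradient_of_minimizer_add (hconv : IsConvexFun f)
    {k : X → ℝ} (hk : ConvexOn ℝ Set.univ k) (hkc : Continuous k) {z : X} {r : ℝ} (hr : f z = r)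
    (hmin : ∀ (x : X) (s : ℝ), f x ≤ s → r + k z ≤ s + k x) :
    ∃ φ : StrongDual ℝ X, (∀ (x : X) (s : ℝ), f x ≤ s → r + φ (x - z) ≤ s) ∧
      ∀ x, k z - φ (x - z) ≤ k x := by
  -- Separate the epigraph of `f` from this strict hypograph; continuity of `k` makes it open,
  -- minimality makes it disjoint.
  let B : Set (X × ℝ) := {p | p.2 < r + k z - k p.1}
  have hBo : IsOpen B := isOpen_lt (by fun_prop) (by fun_prop)
  have hBc : Convex ℝ B := by
    intro p hp q hq a b ha hb hab
    have h2 := hk.2 (Set.mem_univ p.1) (Set.mem_univ q.1) ha hb hab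
    have : a * (r + k z) + b * (r + k z) = r + k z := by rw [← add_mul, hab, one_mul]
    simp only [B, Set.mem_ofPred_eq, Prod.snd_add, Prod.fst_add, Prod.smul_fst, Prod.smul_snd,
      smul_eq_mul] at hp hq h2 ⊢
    have h3 : a * p.2 + b * q.2 < a * (r + k z - k p.1) + b * (r + k z - k q.1) := by
      rcases ha.eq_or_lt with rfl | ha
      · have : b = 1 := by linarith
        subst this; linarith
      · have := mul_lt_mul_of_pos_left hp ha
        have := mul_le_mul_of_nonneg_left hq.le hb
        linarith
    linarith
  have hdisj : Disjoint B {p : X × ℝ | f p.1 ≤ (p.2 : EReal)} := by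
    rw [Set.disjoint_left]
    intro p hp hp'
    have := hmin p.1 p.2 hp'
    simp only [B, Set.mem_ofPred_eq] at hp
    linarith
  obtain ⟨Φ, u, hB, hA⟩ := geometric_hahn_banach_open hBc hBo hconv hdisj
  have h1 := hA (z, r) (by simp [hr])
  have h2 := hB (z, r - 1) (by simp only [B, Set.mem_ofPred_eq]; linarith)
  rw [clm_prod_real_apply] at h1 h2
  have hβ : 0 < Φ (0, 1) := by linarith
  have hB' (x : X) : Φ (x, 0) + (r + k z - k x) * Φ (0, 1) ≤ u := by
    refine le_of_forall_pos_lt_add fun ε hε => ?_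
    have h3 := hB (x, r + k z - k x - ε / Φ (0, 1)) (by
      have : 0 < ε / Φ (0, 1) := by positivity
      simp only [B, Set.mem_ofPred_eq]; linarith)
    rw [clm_prod_real_apply, sub_mul, div_mul_cancel₀ _ hβ.ne'] at h3
    linarith
  have hu : Φ (z, 0) + r * Φ (0, 1) = u :=
    le_antisymm (by simpa using hB' z) h1
  have hsub (x : X) : Φ (x - z, 0) = Φ (x, 0) - Φ (z, 0) := by
    rw [← map_sub]; simp
  have hφ (x : X) : (-(Φ (0, 1))⁻¹ • Φ.comp (ContinuousLinearMap.inl ℝ X ℝ)) (x - z) =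
      -((Φ (x, 0) - Φ (z, 0)) / Φ (0, 1)) := by
    simp only [_root_.smul_apply, ContinuousLinearMap.comp_apply,
      ContinuousLinearMap.inl_apply, smul_eq_mul, hsub]
    ring
  refine ⟨-(Φ (0, 1))⁻¹ • Φ.comp (ContinuousLinearMap.inl ℝ X ℝ), fun x s hs => ?_, fun x => ?_⟩
  · have h3 := hA (x, s) hs
    rw [clm_prod_real_apply] at h3
    have : r - s ≤ (Φ (x, 0) - Φ (z, 0)) / Φ (0, 1) := by
      rw [le_div_iff₀ hβ]; linarith
    rw [hφ]; linarith
  · have h3 := hB' x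
    have : (Φ (x, 0) - Φ (z, 0)) / Φ (0, 1) ≤ k x - k z := by
      rw [div_le_iff₀ hβ]; linarith
    rw [hφ]; linarith

theorem mem_subdiff_of_forall {x : X} {r : ℝ} {φ : StrongDual ℝ X} (hr : f x = r)
    (h : ∀ (y : X) (s : ℝ), f y ≤ s → r + φ (y - x) ≤ s) : φ ∈ subdiff f x := by
  refine ⟨hr ▸ EReal.coe_lt_top r, fun w => ?_⟩
  rw [hr]
  induction hw : f w using EReal.rec with
  -- Excluded: the hypothesis bounds below every real `s ≥ f w`.
  | bot => have := h w (r + φ (w - x) - 1) (by simp [hw]); linarith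
  | top => simp
  | coe s =>
    have := h w s hw.le
    rw [← EReal.coe_sub, EReal.coe_le_coe_iff]
    simp only [NNReal.coe_zero]
    linarith

theorem exists_real_of_mem_subdiff (hproper : IsProper f) {x : X} {φ : StrongDual ℝ X}
    (h : φ ∈ subdiff f x) :
    ∃ r : ℝ, f x = r ∧ ∀ (y : X) (s : ℝ), f y = s → r + φ (y - x) ≤ s := by
  have hx := h.1
  refine ⟨(f x).toReal, (EReal.coe_toReal hx.ne (hproper.1 x)).symm, fun y s hs => ?_⟩
  have h1 := h.2 y
  rw [hs, ← EReal.coe_toReal hx.ne (hproper.1 x), ← EReal.coe_sub, EReal.coe_le_coe_iff] at h1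
  simp only [NNReal.coe_zero] at h1
  linarith

theorem monotone_subdiff (hproper : IsProper f) {x y : X} {x' y' : StrongDual ℝ X}
    (hx : x' ∈ subdiff f x) (hy : y' ∈ subdiff f y) : 0 ≤ (x' - y') (x - y) := by
  obtain ⟨r, hr, h1⟩ := exists_real_of_mem_subdiff hproper hx
  obtain ⟨s, hs, h2⟩ := exists_real_of_mem_subdiff hproper hy
  have h1 := h1 y s hs
  have h2 := h2 x r hr
  rw [_root_.sub_apply]
  rw [← neg_sub, map_neg] at h1
  linarith

/-- Solvability of the regularized inclusion `x₀' ∈ ∂f(z) + J(z - x₀)` with `J` the subdifferential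
of `½‖·‖²`. -/
theorem exists_mem_subdiff_add_duality (hX : Reflexive X) (hproper : IsProper f)
    (hconv : IsConvexFun f) (hlsc : LowerSemicontinuous f) (x₀ : X) (x₀' : StrongDual ℝ X) :
    ∃ (z : X) (z' : StrongDual ℝ X), z' ∈ subdiff f z ∧
      ∀ x, ‖z - x₀‖ ^ 2 / 2 + (x₀' - z') (x - z) ≤ ‖x - x₀‖ ^ 2 / 2 := by
  let k : X → ℝ := fun x => (1 / 2 : ℝ) * ‖x - x₀‖ ^ 2 - x₀' x
  have hk : ConvexOn ℝ Set.univ k := by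
    have h1 : ConvexOn ℝ Set.univ fun x : X => ‖x - x₀‖ ^ 2 := by
      simp only [← dist_eq_norm]
      exact (convexOn_dist x₀ convex_univ).pow (fun _ _ => dist_nonneg) 2
    exact (h1.smul (by norm_num : (0 : ℝ) ≤ 1 / 2)).sub
      (x₀'.toLinearMap.concaveOn convex_univ)
  have hkc : Continuous k := by fun_prop
  have hb (c : ℝ) : Bornology.IsBounded {x | f x ≤ ((c - k x : ℝ) : EReal)} := by
    obtain ⟨φ, c₀, hφ⟩ := exists_affine_minorant hproper hconv hlsc
    set a := ‖x₀' - φ‖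
    set b := |(x₀' - φ) x₀ + c + c₀|
    have ha : 0 ≤ a := norm_nonneg _
    have hb : 0 ≤ b := abs_nonneg _
    -- Beyond this radius `n = ‖x - x₀‖ ≥ 1` and `n² / 2 > (a + b) n ≥ a n + b`, contradicting `h4`.
    refine (Metric.isBounded_closedBall (x := x₀) (r := 2 * a + 2 * b + 1)).subset fun x hx => ?_
    have h1 := hφ x _ hx
    have h2 : (x₀' - φ) (x - x₀) ≤ a * ‖x - x₀‖ :=
      (le_abs_self _).trans ((x₀' - φ).le_opNorm _)
    have h3 := le_abs_self ((x₀' - φ) x₀ + c + c₀)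
    rw [Metric.mem_closedBall, dist_eq_norm]
    rw [map_sub] at h2
    simp only [_root_.sub_apply, k] at h1 h2 h3
    have h4 : ‖x - x₀‖ ^ 2 / 2 ≤ a * ‖x - x₀‖ + b := by
      simp only [b, _root_.sub_apply]; linarith
    by_contra! h5
    nlinarith [mul_nonneg hb (by linarith : 0 ≤ ‖x - x₀‖ - 1),
      mul_pos (by linarith : 0 < ‖x - x₀‖) (sub_pos.2 h5)]
  obtain ⟨z, r, hr, hmin⟩ := exists_minimizer_add hX hproper hconv hlsc hk hkc hb
  obtain ⟨z', h1, h2⟩ := exists_subgradient_of_minimizer_add hconv hk hkc hr hmin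
  refine ⟨z, z', mem_subdiff_of_forall hr h1, fun x => ?_⟩
  have h3 := h2 x
  simp only [k, map_sub, _root_.sub_apply] at h3 ⊢
  linarith

theorem eq_zero_of_forall_le_norm_sq {φ : StrongDual ℝ X} (h : ∀ x, φ x ≤ ‖x‖ ^ 2 / 2) :
    φ = 0 := by
  have hle (x : X) : φ x ≤ 0 := by
    by_contra! hx
    have hx0 : 0 < ‖x‖ := norm_pos_iff.2 (by rintro rfl; simp at hx)
    -- This multiple `t` maximizes `t φ x - t² ‖x‖² / 2`.
    have h1 := h ((φ x / ‖x‖ ^ 2) • x)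
    rw [map_smul, norm_smul, Real.norm_of_nonneg (by positivity), smul_eq_mul] at h1
    have h2 : (φ x / ‖x‖ ^ 2 * ‖x‖) ^ 2 / 2 = φ x / ‖x‖ ^ 2 * φ x / 2 := by
      field_simp
    have : 0 < φ x / ‖x‖ ^ 2 * φ x := by positivity
    linarith
  ext x
  have := hle (-x)
  rw [map_neg] at this
  exact le_antisymm (hle x) (neg_nonpos.1 this)

/-- Rockafellar's theorem in reflexive spaces: the subdifferential is maximal monotone. -/
theorem mem_subdiff_of_monotone_related (hX : Reflexive X) (hproper : IsProper f)
    (hconv : IsConvexFun f) (hlsc : LowerSemicontinuous f) {x₀ : X} {x₀' : StrongDual ℝ X}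
    (h : ∀ y, ∀ y' ∈ subdiff f y, 0 ≤ (x₀' - y') (x₀ - y)) : x₀' ∈ subdiff f x₀ := by
  obtain ⟨z, z', hz, hJ⟩ := exists_mem_subdiff_add_duality hX hproper hconv hlsc x₀ x₀'
  have h1 := hJ x₀
  have h2 := h z z' hz
  simp only [sub_self, norm_zero] at h1
  have h3 : ‖z - x₀‖ ^ 2 ≤ 0 := by linarith
  have h4 : z = x₀ := by
    rw [← sub_eq_zero, ← norm_eq_zero]
    exact pow_eq_zero_iff two_ne_zero |>.1 (le_antisymm h3 (by positivity))
  subst h4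
  have h5 : x₀' - z' = 0 := eq_zero_of_forall_le_norm_sq fun v => by
    simpa using hJ (z + v)
  rwa [sub_eq_zero.1 h5]

end

/-! ### Conjugates and their level sets. -/

theorem conj_le_coe_iff {Z : Type*} [NormedAddCommGroup Z] [NormedSpace ℝ Z] {f : Z → EReal}
    {z' : StrongDual ℝ Z} {s : ℝ} :
    conj f z' ≤ s ↔ ∀ z, ((z' z - s : ℝ) : EReal) ≤ f z := by
  refine iSup_le_iff.trans (forall_congr' fun z => ?_)
  induction f z using EReal.rec with
  | bot => simp [-EReal.coe_sub]
  | top => simp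
  | coe r =>
    rw [← EReal.coe_sub, EReal.coe_le_coe_iff, EReal.coe_le_coe_iff]
    exact sub_le_comm

section

variable {X : Type*} [NormedAddCommGroup X] [NormedSpace ℝ X]

theorem conjSwap_le_coe_iff {h : X × StrongDual ℝ X → EReal} {x : X} {x' : StrongDual ℝ X}
    {s : ℝ} :
    conjSwap h (x, x') ≤ s ↔ ∀ w w', ((x' w + w' x - s : ℝ) : EReal) ≤ h (w, w') :=
  conj_le_coe_iff.trans Prod.forall

theorem mem_levelEnl_conjSwap_iff {h : X × StrongDual ℝ X → EReal} {ε : ℝ≥0} {x : X}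
    {x' : StrongDual ℝ X} :
    x' ∈ levelEnl (conjSwap h) ε x ↔
      ∀ w w', ((x' w + w' x - (x' x + ε) : ℝ) : EReal) ≤ h (w, w') :=
  conjSwap_le_coe_iff

/-- The graph of `L^{h* ∘ i}` is closed. -/
theorem isClosed_graph_levelEnl_conjSwap (h : X × StrongDual ℝ X → EReal) :
    IsClosed {q : ℝ≥0 × X × StrongDual ℝ X | q.2.2 ∈ levelEnl (conjSwap h) q.1 q.2.1} := by
  simp only [mem_levelEnl_conjSwap_iff, Set.ofPred_forall]
  refine isClosed_iInter fun w => isClosed_iInter fun w' => ?_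
  refine isClosed_le (continuous_coe_real_ereal.comp ?_) continuous_const
  have hc : Continuous fun q : ℝ≥0 × X × StrongDual ℝ X => q.2.2 q.2.1 :=
    (continuous_snd.comp continuous_snd).clm_apply (continuous_fst.comp continuous_snd)
  have hc' : Continuous fun q : ℝ≥0 × X × StrongDual ℝ X => q.2.2 w :=
    (continuous_snd.comp continuous_snd).clm_apply continuous_const
  fun_prop

/-- The function `h* ∘ i` is convex. -/
theorem conjSwap_convex_combination_le {h : X × StrongDual ℝ X → EReal} {x₁ x₂ : X}
    {x₁' x₂' : StrongDual ℝ X} {s t α : ℝ} (h₁ : conjSwap h (x₁, x₁') ≤ s)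
    (h₂ : conjSwap h (x₂, x₂') ≤ t) (h0 : 0 ≤ α) (h1 : α ≤ 1) :
    conjSwap h (α • x₁ + (1 - α) • x₂, α • x₁' + (1 - α) • x₂') ≤
      ((α * s + (1 - α) * t : ℝ) : EReal) := by
  rw [conjSwap_le_coe_iff] at h₁ h₂ ⊢
  intro w w'
  -- A convex combination of two lower bounds is at most their maximum, so no arithmetic in `EReal`
  -- is needed.
  refine le_trans ?_ (max_le (h₁ w w') (h₂ w w'))
  rw [← EReal.coe_strictMono.monotone.map_max, EReal.coe_le_coe_iff]
  have h3 := mul_le_mul_of_nonneg_left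
    (le_max_left (x₁' w + w' x₁ - s) (x₂' w + w' x₂ - t)) h0
  have h4 := mul_le_mul_of_nonneg_left
    (le_max_right (x₁' w + w' x₁ - s) (x₂' w + w' x₂ - t)) (sub_nonneg.2 h1)
  simp only [add_apply, _root_.smul_apply, map_add, map_smul, smul_eq_mul]
  linarith

/-- The quantity in the transportation formula, expressed through the duality pairing. -/
theorem transport_identity (x₁ x₂ : X) (x₁' x₂' : StrongDual ℝ X) (α ε₁ ε₂ : ℝ) :
    α * ε₁ + (1 - α) * ε₂ +
        α * (x₁' - (α • x₁' + (1 - α) • x₂')) (x₁ - (α • x₁ + (1 - α) • x₂)) +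
        (1 - α) * (x₂' - (α • x₁' + (1 - α) • x₂')) (x₂ - (α • x₁ + (1 - α) • x₂)) =
      α * (x₁' x₁ + ε₁) + (1 - α) * (x₂' x₂ + ε₂) -
        (α • x₁' + (1 - α) • x₂') (α • x₁ + (1 - α) • x₂) := by
  simp only [add_apply, _root_.sub_apply, _root_.smul_apply, map_add, map_sub, map_smul,
    smul_eq_mul]
  ring

/-! ### The Fitzpatrick function and the level enlargement. -/

variable {T : X → Set (StrongDual ℝ X)}

theorem le_fitzpatrick {y : X} {y' : StrongDual ℝ X} (hy : y' ∈ T y)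
    (p : X × StrongDual ℝ X) : ((p.2 y + y' (p.1 - y) : ℝ) : EReal) ≤ fitzpatrick T p :=
  le_iSup₂_of_le y y' (le_iSup_of_le hy le_rfl)

theorem fitzpatrick_le_coe_iff {x : X} {x' : StrongDual ℝ X} {c : ℝ} :
    fitzpatrick T (x, x') ≤ c ↔ ∀ y, ∀ y' ∈ T y, x' y + y' (x - y) ≤ c := by
  simp only [fitzpatrick, iSup_le_iff, EReal.coe_le_coe_iff]

theorem fitzpatrick_le_of_mem
    (hmono : ∀ x, ∀ x' ∈ T x, ∀ y, ∀ y' ∈ T y, 0 ≤ (x' - y') (x - y))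
    {x : X} {x' : StrongDual ℝ X} (hx : x' ∈ T x) : fitzpatrick T (x, x') ≤ (x' x : ℝ) := by
  refine fitzpatrick_le_coe_iff.2 fun y y' hy => ?_
  have := hmono x x' hx y y' hy
  simp only [_root_.sub_apply, map_sub] at this ⊢
  linarith

theorem pairing_le_fitzpatrick
    (hmax : ∀ x x', (∀ y, ∀ y' ∈ T y, 0 ≤ (x' - y') (x - y)) → x' ∈ T x)
    (x : X) (x' : StrongDual ℝ X) : ((x' x : ℝ) : EReal) ≤ fitzpatrick T (x, x') := by
  by_cases hx : x' ∈ T x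
  · simpa using le_fitzpatrick hx (x, x')
  · have := mt (hmax x x') hx
    push Not at this
    obtain ⟨y, y', hy, hlt⟩ := this
    refine le_trans (EReal.coe_le_coe_iff.2 ?_) (le_fitzpatrick hy (x, x'))
    simp only [_root_.sub_apply, map_sub] at hlt ⊢
    linarith

/-- Testing the conjugate on graph points, where `F_T` is at most the pairing, gives `F_T ≤ F_T* ∘
i`. This is what makes the `ε` of the transportation formula nonnegative. -/
theorem pairing_le_of_conjSwap_fitzpatrick_le
    (hmono : ∀ x, ∀ x' ∈ T x, ∀ y, ∀ y' ∈ T y, 0 ≤ (x' - y') (x - y))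
    (hmax : ∀ x x', (∀ y, ∀ y' ∈ T y, 0 ≤ (x' - y') (x - y)) → x' ∈ T x)
    {x : X} {x' : StrongDual ℝ X} {s : ℝ} (h : conjSwap (fitzpatrick T) (x, x') ≤ s) :
    x' x ≤ s := by
  rw [conjSwap_le_coe_iff] at h
  refine EReal.coe_le_coe_iff.1 ((pairing_le_fitzpatrick hmax x x').trans ?_)
  refine fitzpatrick_le_coe_iff.2 fun y y' hy => ?_
  have := EReal.coe_le_coe_iff.1 ((h y y').trans (fitzpatrick_le_of_mem hmono hy))
  rw [map_sub]
  linarith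

/-- For a maximal monotone `T`, `L^{F_T* ∘ i}` is a closed enlargement of `T`. -/
theorem levelEnl_conjSwap_fitzpatrick_mem_closedEnl
    (hmono : ∀ x, ∀ x' ∈ T x, ∀ y, ∀ y' ∈ T y, 0 ≤ (x' - y') (x - y))
    (hmax : ∀ x x', (∀ y, ∀ y' ∈ T y, 0 ≤ (x' - y') (x - y)) → x' ∈ T x) :
    levelEnl (conjSwap (fitzpatrick T)) ∈ closedEnl T := by
  refine ⟨⟨fun ε x x' hx => ?_, fun ε₁ ε₂ hε x x' hx => ?_, ?_⟩,
    isClosed_graph_levelEnl_conjSwap _⟩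
  · refine mem_levelEnl_conjSwap_iff.2 fun w w' => ?_
    refine le_trans (EReal.coe_le_coe_iff.2 ?_) (le_fitzpatrick hx (w, w'))
    simp only [map_sub]
    linarith [ε.coe_nonneg]
  · exact le_trans hx (EReal.coe_le_coe_iff.2 (by gcongr))
  · rintro ε₁ ε₂ x₁ x₂ x₁' x₂' α h₁ h₂ h0 h1 x x' ε rfl rfl hε
    rw [transport_identity] at hε
    have h := conjSwap_convex_combination_le h₁ h₂ h0 h1
    have hle := pairing_le_of_conjSwap_fitzpatrick_le hmono hmax h
    refine ⟨by linarith, h.trans (EReal.coe_le_coe_iff.2 ?_)⟩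
    change _ ≤ _ + ε
    linarith

/-! ### Minimality by separation. -/

/-- In a reflexive space every continuous linear functional on `X × X*` is given by a pair. -/
theorem exists_eq_dualPair (hX : Reflexive X) (Φ : StrongDual ℝ (X × StrongDual ℝ X)) :
    ∃ (v : X) (v' : StrongDual ℝ X), Φ = dualPair v' v := by
  obtain ⟨v, hv⟩ := hX (Φ.comp (ContinuousLinearMap.inr ℝ X (StrongDual ℝ X)))
  refine ⟨v, Φ.comp (ContinuousLinearMap.inl ℝ X (StrongDual ℝ X)), ?_⟩
  rw [dualPair, hv]
  ext p <;> simp <;> exact map_zero Φ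

/-- The epigraph of `(x, x') ↦ inf {⟨x, x'⟩ + ε : x' ∈ E (ε, x)}`. -/
def enlEpigraph (E : ℝ≥0 → X → Set (StrongDual ℝ X)) : Set ((X × StrongDual ℝ X) × ℝ) :=
  {p | p.1.2 p.1.1 ≤ p.2 ∧ p.1.2 ∈ E (p.2 - p.1.2 p.1.1).toNNReal p.1.1}

theorem convex_enlEpigraph {E : ℝ≥0 → X → Set (StrongDual ℝ X)} (hE : IsEnlargement T E) :
    Convex ℝ (enlEpigraph E) := by
  rintro ⟨⟨x, x'⟩, s⟩ ⟨hs, hx⟩ ⟨⟨y, y'⟩, t⟩ ⟨ht, hy⟩ a b ha hb hab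
  obtain rfl : b = 1 - a := by linarith
  obtain ⟨hε, h⟩ := hE.transport _ _ x y x' y' a hx hy ha (by linarith) _ _ _ rfl rfl rfl
  dsimp only at hs ht
  simp only [transport_identity, Real.coe_toNNReal _ (sub_nonneg.2 hs),
    Real.coe_toNNReal _ (sub_nonneg.2 ht), add_sub_cancel] at hε h
  refine ⟨sub_nonneg.1 hε, ?_⟩
  change _ ∈ E (a * s + (1 - a) * t -
    (a • x' + (1 - a) • y') (a • x + (1 - a) • y)).toNNReal _
  rw [Real.toNNReal_of_nonneg hε]
  exact h

theorem isClosed_enlEpigraph {E : ℝ≥0 → X → Set (StrongDual ℝ X)}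
    (hE : IsClosed {q : ℝ≥0 × X × StrongDual ℝ X | q.2.2 ∈ E q.1 q.2.1}) :
    IsClosed (enlEpigraph E) := by
  have hc : Continuous fun p : (X × StrongDual ℝ X) × ℝ => p.1.2 p.1.1 :=
    (continuous_snd.comp continuous_fst).clm_apply (continuous_fst.comp continuous_fst)
  refine (isClosed_le hc continuous_snd).inter (hE.preimage
    (f := fun p : (X × StrongDual ℝ X) × ℝ =>
      ((p.2 - p.1.2 p.1.1).toNNReal, p.1.1, p.1.2)) ?_)
  exact (continuous_real_toNNReal.comp (continuous_snd.sub hc)).prodMk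
    ((continuous_fst.comp continuous_fst).prodMk (continuous_snd.comp continuous_fst))

/-- In a reflexive space, `L^{F_T* ∘ i}` is contained in every closed enlargement of a nonempty
monotone `T`. -/
theorem levelEnl_conjSwap_fitzpatrick_subset (hX : Reflexive X)
    (hmono : ∀ x, ∀ x' ∈ T x, ∀ y, ∀ y' ∈ T y, 0 ≤ (x' - y') (x - y))
    (hne : ∃ y, (T y).Nonempty) {E : ℝ≥0 → X → Set (StrongDual ℝ X)} (hE : E ∈ closedEnl T)
    (ε : ℝ≥0) (x : X) : levelEnl (conjSwap (fitzpatrick T)) ε x ⊆ E ε x := by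
  obtain ⟨y₀, y₀', hy₀⟩ := hne
  intro x' hx
  suffices h : ((x, x'), x' x + (ε : ℝ)) ∈ enlEpigraph E by
    simpa [enlEpigraph] using h
  by_contra hnot
  obtain ⟨Φ, u, hC, hu⟩ := geometric_hahn_banach_closed_point (convex_enlEpigraph hE.1)
    (isClosed_enlEpigraph hE.2) hnot
  obtain ⟨v, v', hv⟩ := exists_eq_dualPair hX
    (Φ.comp (ContinuousLinearMap.inl ℝ (X × StrongDual ℝ X) ℝ))
  have hΦ (y : X) (y' : StrongDual ℝ X) (s : ℝ) :
      Φ ((y, y'), s) = v' y + y' v + s * Φ (0, 1) := by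
    rw [clm_prod_real_apply]
    congr 1
    exact congr($hv (y, y'))
  have hT (y : X) (y' : StrongDual ℝ X) (hy : y' ∈ T y) (s : ℝ) (hs : y' y ≤ s) :
      v' y + y' v + s * Φ (0, 1) < u := by
    rw [← hΦ]
    exact hC _ ⟨hs, hE.1.subset _ _ hy⟩
  rw [hΦ] at hu
  have hlevel := mem_levelEnl_conjSwap_iff.1 hx
  generalize Φ (0, 1) = β at hu hT
  rcases lt_trichotomy β 0 with hβ | rfl | hβ
  -- Non-vertical hyperplane: rescaled to slope `-1`, it bounds `F_T` at a single point, too low for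
  -- the level condition.
  · have hγ : 0 < -β⁻¹ := neg_pos.2 (inv_lt_zero.2 hβ)
    have hγβ : -β⁻¹ * β = -1 := by rw [neg_mul, inv_mul_cancel₀ hβ.ne]
    have hF : fitzpatrick T (-β⁻¹ • v, -β⁻¹ • v') ≤ ((-β⁻¹ * u : ℝ) : EReal) := by
      refine fitzpatrick_le_coe_iff.2 fun y y' hy => ?_
      have h1 := mul_le_mul_of_nonneg_left (hT y y' hy _ le_rfl).le hγ.le
      have h2 : -β⁻¹ * (y' y * β) = -y' y := by linear_combination y' y * hγβ
      simp only [_root_.smul_apply, map_sub, map_smul, smul_eq_mul]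
      linarith
    have h1 := EReal.coe_le_coe_iff.1 ((hlevel _ _).trans hF)
    have h2 := mul_lt_mul_of_pos_left hu hγ
    have h3 : -β⁻¹ * ((x' x + ε) * β) = -(x' x + ε) := by linear_combination (x' x + ε) * hγβ
    simp only [_root_.smul_apply, map_smul, smul_eq_mul] at h1
    linarith
  -- Vertical hyperplane: along a ray from a graph point `F_T` grows at rate at most `u`, while the
  -- level condition demands the larger rate `v' x + x' v`; `k` below is large enough to conflict.
  · have hF (k : ℝ) (hk : 0 ≤ k) :
        fitzpatrick T (y₀ + k • v, y₀' + k • v') ≤ ((y₀' y₀ + k * u : ℝ) : EReal) := by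
      refine fitzpatrick_le_coe_iff.2 fun y y' hy => ?_
      have h1 := mul_le_mul_of_nonneg_left (hT y y' hy _ le_rfl).le hk
      have h2 := hmono y₀ y₀' hy₀ y y' hy
      simp only [_root_.smul_apply, _root_.sub_apply, add_apply, map_sub, map_add, map_smul,
        smul_eq_mul] at h2 ⊢
      linarith
    have hδ : 0 < v' x + x' v - u := by linarith
    set c := x' x + ε + y₀' y₀ - x' y₀ - y₀' x with hc
    set k := (|c| + 1) / (v' x + x' v - u) with hk
    have hk0 : 0 ≤ k := by positivity
    have h1 := EReal.coe_le_coe_iff.1 ((hlevel _ _).trans (hF k hk0))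
    have h2 : k * (v' x + x' v - u) = |c| + 1 := div_mul_cancel₀ _ hδ.ne'
    simp only [_root_.smul_apply, add_apply, map_add, map_smul, smul_eq_mul] at h1
    linarith [le_abs_self c]
  -- Impossible: the height over a graph point is unbounded above.
  · have h1 := hT y₀ y₀' hy₀ (max (y₀' y₀) ((u - (v' y₀ + y₀' v)) / β)) (le_max_left _ _)
    have h2 := (div_le_iff₀ hβ).1 (le_max_right (y₀' y₀) ((u - (v' y₀ + y₀' v)) / β))
    linarith

/-- Replacing `F_T (x, x')` by the smaller `⟨x, x'⟩` in the `ε`-subgradient inequality cancels one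
of its two pairing terms. -/
theorem breveEnl_fitzpatrick_subset_levelEnl
    (hmax : ∀ x x', (∀ y, ∀ y' ∈ T y, 0 ≤ (x' - y') (x - y)) → x' ∈ T x) (ε : ℝ≥0) (x : X) :
    breveEnl (fitzpatrick T) (ε / 2) x ⊆ levelEnl (conjSwap (fitzpatrick T)) ε x := by
  rintro x' ⟨htop, h⟩
  rw [mul_div_cancel₀ _ two_ne_zero] at h
  have hge := pairing_le_fitzpatrick hmax x x'
  refine mem_levelEnl_conjSwap_iff.2 fun w w' => ?_
  have h1 := h (w, w')
  lift fitzpatrick T (x, x') to ℝ using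
    ⟨htop.ne, ((EReal.bot_lt_coe _).trans_le hge).ne'⟩ with r
  rw [EReal.coe_le_coe_iff] at hge
  rw [EReal.le_sub_iff_add_le (by simp) (by simp), ← EReal.coe_add] at h1
  refine le_trans (EReal.coe_le_coe_iff.2 ?_) h1
  simp only [dualPair_apply, map_sub]
  linarith

end

end ConvEnl

theorem proposition4p3 {X : Type*} [NormedAddCommGroup X] [NormedSpace ℝ X] [CompleteSpace X]
    (hX : ConvEnl.Reflexive X) (f : X → EReal) (hproper : ConvEnl.IsProper f)
    (hconv : ConvEnl.IsConvexFun f) (hlsc : LowerSemicontinuous f) :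
    IsLeast (ConvEnl.closedEnl (ConvEnl.subdiff f))
        (ConvEnl.smallestEnl (ConvEnl.subdiff f)) ∧
      ConvEnl.smallestEnl (ConvEnl.subdiff f) =
        ConvEnl.levelEnl (ConvEnl.conjSwap (ConvEnl.fitzpatrick (ConvEnl.subdiff f))) ∧
      ∀ (ε : ℝ≥0) (x : X),
        ConvEnl.breveEnl (ConvEnl.fitzpatrick (ConvEnl.subdiff f)) (ε / 2) x ⊆
          ConvEnl.smallestEnl (ConvEnl.subdiff f) ε x := by
  have hmono : ∀ x, ∀ x' ∈ ConvEnl.subdiff f x, ∀ y, ∀ y' ∈ ConvEnl.subdiff f y,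
      0 ≤ (x' - y') (x - y) := fun x x' hx y y' hy => ConvEnl.monotone_subdiff hproper hx hy
  have hmax : ∀ x x', (∀ y, ∀ y' ∈ ConvEnl.subdiff f y, 0 ≤ (x' - y') (x - y)) →
      x' ∈ ConvEnl.subdiff f x := fun x x' h =>
    ConvEnl.mem_subdiff_of_monotone_related hX hproper hconv hlsc h
  have hne : ∃ y, (ConvEnl.subdiff f y).Nonempty := by
    obtain ⟨z, z', hz, -⟩ :=
      ConvEnl.exists_mem_subdiff_add_duality hX hproper hconv hlsc 0 0
    exact ⟨z, z', hz⟩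
  have hmem := ConvEnl.levelEnl_conjSwap_fitzpatrick_mem_closedEnl hmono hmax
  have heq : ConvEnl.smallestEnl (ConvEnl.subdiff f) =
      ConvEnl.levelEnl (ConvEnl.conjSwap (ConvEnl.fitzpatrick (ConvEnl.subdiff f))) := by
    funext ε x
    exact Set.Subset.antisymm (fun x' hx => hx _ hmem) fun x' hx E hE =>
      ConvEnl.levelEnl_conjSwap_fitzpatrick_subset hX hmono hne hE ε x hx
  refine ⟨⟨heq ▸ hmem, fun E hE ε x x' hx => hx E hE⟩, heq, fun ε x => ?_⟩
  rw [heq]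
  exact ConvEnl.breveEnl_fitzpatrick_subset_levelEnl hmax ε x
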